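/- Let $AP$ be a finite set of propositions, $\Sigma = 2^{AP}$, and let $\varphi$ be an LTL$_f$ or pure-past LTL (PPLTL) formula over $AP$; $[\varphi]$ is the set of non-empty finite traces over $\Sigma$ that satisfy $\varphi$. Let $D=(Q,\iota,\delta,F)$ be a complete DFA with language $[\varphi]$ and let $C$ be a complete DFA with language $[\neg\varphi]$. **Automata.** All $\omega$-automata are complete and have finitely many states. A Büchi (co-Büchi) condition given by a set $X$ of states accepts a run iff some (no) state of $X$ occurs in it infinitely often. DBA and DCA are the deterministic Büchi and co-Büchi automata; an LDBA is a Büchi automaton in which every state that a run can visit at or after an accepting state has at most one successor per letter. * $\mathcal B_{\exists\varphi}$ is $D$ with its final states made sinks ($\delta(s,a)=s$ for $s\in F$), read as a Büchi automaton with accepting set $F$. * $\mathcal B_{\forall\varphi}$ is obtained from $C$ by making its final states sinks, removing the unreachable states, and taking the non-final states as Büchi accepting set. * $\mathcal B_{\forall\exists\varphi}$ is $D$ read as a Büchi automaton. * $\mathcal A_{\exists\forall\varphi}$ is the complement DFA $(Q,\iota,\delta,Q\setminus F)$ read as a co-Büchi automaton with rejecting set $Q\setminus F$. * $\mathcal B_{\exists\forall\varphi}$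 has states $Q\times\{0,1\}$, initial state $\langle\iota,0\rangle$, accepting set $F\times\{1\}$, and for all $q\in Q$, $a\in\Sigma$ and $q'=\delta(q,a)$ the transitions $\langle q,0\rangle\to\langle q',0\rangle$; $\langle q,0\rangle\to\langle q',1\rangle$ if $q'\in F$ (jump); and $\langle q,1\rangle\to\langle q',1\rangle$ if $q,q'\in F$, each reading $a$. It is completed by adding a non-accepting sink that receives all missing transitions. **Good for MDPs.** For a finite MDP $\mathcal M$ with states labelled in $\Sigma$ and an automaton $\mathcal A$, $\mathsf{Psem}(\mathcal M,\mathcal A)$ is the supremum, over all history-dependent randomised strategies of $\mathcal M$, of the probability that the label sequence of the path is in the language of $\mathcal A$. $\mathsf{Psyn}(\mathcal M,\mathcal A)$ is the supremum, over all such strategies of the product $\mathcal M\times\mathcal A$, of the probability that the sequence of automaton states on the path is accepting; here, in state $\langle s,q\rangle$, an action is a pair $\langle a,q'\rangle$ of an action $a$ enabled in $s$ and a successor $q'$ of $q$ on the label of $s$, and it leads to $\langle s',q'\rangle$ with probability $P(s,a,s')$. $\mathcal A$ is *good for MDPs* (GFM) if $\mathsf{Psem}(\mathcal M,\mathcal A)=\mathsf{Psyn}(\mathcal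 M,\mathcal A)$ for all finite MDPs $\mathcal M$. **AEC-simulation.** In the accepting end-component (AEC) simulation game for $\mathcal B$ and $\mathcal A$, in every round Spoiler chooses a letter and a transition of $\mathcal A$ from her current state, and Duplicator answers with a transition of $\mathcal B$ over the same letter from his current state; both start in the initial states. At most once, together with a move, Spoiler may make an AEC claim, a collection $\Lambda$ of finite sequences of transitions of $\mathcal A$. Her play complies with the claim if $\Lambda$ consists of exactly the non-empty finite sequences of transitions that occur infinitely often in her run, and every non-empty finite sequence of transitions that occurs after the move with the claim is in $\Lambda$. Duplicator wins a play iff Spoiler never makes a claim, or his run in $\mathcal B$ is accepting, or her play does not comply with her claim, or her run in $\mathcal A$ is not accepting. $\mathcal B$ *AEC-simulates* $\mathcal A$ if Duplicator has a winning strategy. **Theorem.** $\mathcal B_{\exists\varphi}$, $\mathcal B_{\forall\varphi}$, $\mathcal B_{\forall\exists\varphi}$ and $\mathcal B_{\exists\forall\varphi}$ are all GFM. The first three are DBAs. Moreover $\mathcal A_{\exists\forall\varphi}$ is a DCA, $\mathcal B_{\exists\forall\varphi}$ is an LDBA, and $\mathcal B_{\exists\forall\varphi}$ AEC-simulates $\mathcal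 A_{\exists\forall\varphi}$. -/

import Mathlib

open Filter MeasureTheory ProbabilityTheory
open scoped ENNReal

/-! ## Finite-trace formulas -/

/-- Syntax of LTL over finite traces. -/
inductive LTLf (AP : Type*) where
  | atom (p : AP) : LTLf AP
  | neg (φ : LTLf AP) : LTLf AP
  | and (φ ψ : LTLf AP) : LTLf AP
  | or (φ ψ : LTLf AP) : LTLf AP
  | next (φ : LTLf AP) : LTLf AP
  | until (φ ψ : LTLf AP) : LTLf AP
  | eventually (φ : LTLf AP) : LTLf AP
  | always (φ : LTLf AP) : LTLf AP

/-- `φ.SatAt w i`: the formula `φ` holds at position `i` of the finite trace `w`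
(positions are `0, …, w.length - 1`; `next` is the strong next operator). -/
def LTLf.SatAt {AP : Type*} (w : List (Set AP)) : LTLf AP → ℕ → Prop
  | .atom p, i => ∃ h : i < w.length, p ∈ w[i]
  | .neg φ, i => ¬ φ.SatAt w i
  | .and φ ψ, i => φ.SatAt w i ∧ ψ.SatAt w i
  | .or φ ψ, i => φ.SatAt w i ∨ ψ.SatAt w i
  | .next φ, i => i + 1 < w.length ∧ φ.SatAt w (i + 1)
  | .until φ ψ, i => ∃ k, i ≤ k ∧ k < w.length ∧ ψ.SatAt w k ∧
      ∀ j, i ≤ j → j < k → φ.SatAt w j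
  | .eventually φ, i => ∃ k, i ≤ k ∧ k < w.length ∧ φ.SatAt w k
  | .always φ, i => ∀ k, i ≤ k → k < w.length → φ.SatAt w k

/-- Syntax of pure-past LTL over finite traces. -/
inductive PPLTL (AP : Type*) where
  | atom (p : AP) : PPLTL AP
  | neg (φ : PPLTL AP) : PPLTL AP
  | and (φ ψ : PPLTL AP) : PPLTL AP
  | or (φ ψ : PPLTL AP) : PPLTL AP
  | yesterday (φ : PPLTL AP) : PPLTL AP
  | since (φ ψ : PPLTL AP) : PPLTL AP

/-- `φ.SatAt w i`: the pure-past formula `φ` holds at position `i` of the finite trace `w`. -/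
def PPLTL.SatAt {AP : Type*} (w : List (Set AP)) : PPLTL AP → ℕ → Prop
  | .atom p, i => ∃ h : i < w.length, p ∈ w[i]
  | .neg φ, i => ¬ φ.SatAt w i
  | .and φ ψ, i => φ.SatAt w i ∧ ψ.SatAt w i
  | .or φ ψ, i => φ.SatAt w i ∨ ψ.SatAt w i
  | .yesterday φ, i => 1 ≤ i ∧ φ.SatAt w (i - 1)
  | .since φ ψ, i => ∃ k, k ≤ i ∧ ψ.SatAt w k ∧ ∀ j, k < j → j ≤ i → φ.SatAt w j

/-- A finite-trace formula: an LTLf formula or a PPLTL formula. -/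
inductive FinTraceFormula (AP : Type*) where
  | ltlf (φ : LTLf AP) : FinTraceFormula AP
  | ppltl (φ : PPLTL AP) : FinTraceFormula AP

namespace FinTraceFormula

/-- Negation of a finite-trace formula. -/
def neg {AP : Type*} : FinTraceFormula AP → FinTraceFormula AP
  | .ltlf φ => .ltlf φ.neg
  | .ppltl φ => .ppltl φ.neg

/-- The language of a finite-trace formula: the set of *non-empty* finite traces over `2^AP` that
satisfy it; LTLf is evaluated at the first position, PPLTL at the last one. -/
def language {AP : Type*} : FinTraceFormula AP → Language (Set AP)
  | .ltlf φ => {w | w ≠ [] ∧ φ.SatAt w 0}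
  | .ppltl φ => {w | w ≠ [] ∧ φ.SatAt w (w.length - 1)}

end FinTraceFormula

/-! ## Transition systems and ω-automata -/

/-- A (nondeterministic) transition system with states `Q` over the alphabet `α`. -/
structure TS (α Q : Type*) where
  /-- the initial state -/
  init : Q
  /-- the transition function -/
  δ : Q → α → Set Q

/-- Every state has at most one successor for every letter. -/
def TS.IsDeterministic {α Q : Type*} (T : TS α Q) : Prop :=
  ∀ q a, (T.δ q a).Subsingleton

/-- `T.Reaches p q`: there is a finite (possibly empty) sequence of transitions from `p` to `q`. -/
def TS.Reaches {α Q : Type*} (T : TS α Q) : Q → Q → Prop :=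
  Relation.ReflTransGen fun p q => ∃ a, q ∈ T.δ p a

open scoped Classical in
/-- Completion of a transition system: missing transitions lead to a fresh sink `none`. -/
noncomputable def TS.completion {α Q : Type*} (T : TS α Q) : TS α (Option Q) where
  init := some T.init
  δ
    | none, _ => {none}
    | some q, a => if (T.δ q a).Nonempty then some '' T.δ q a else {none}

theorem TS.completion_nonempty {α Q : Type*} (T : TS α Q) (x : Option Q) (a : α) :
    (T.completion.δ x a).Nonempty := by
  rcases x with _ | q
  · exact ⟨none, rfl⟩
  · by_cases h : (T.δ q a).Nonempty
    · simp [TS.completion, h]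
    · simp [TS.completion, h]

/-- Büchi acceptance (given by the accepting states) and co-Büchi acceptance (given by the
rejecting states). -/
inductive Acceptance (Q : Type*) where
  | buchi (F : Set Q) : Acceptance Q
  | coBuchi (R : Set Q) : Acceptance Q

/-- The set of states that occur infinitely often in an infinite sequence of states. -/
def infStates {Q : Type*} (ρ : ℕ → Q) : Set Q := {q | ∃ᶠ n in atTop, ρ n = q}

/-- The infinite sequence of states `ρ` satisfies the acceptance condition. -/
def Acceptance.Sat {Q : Type*} : Acceptance Q → (ℕ → Q) → Prop
  | .buchi F, ρ => (infStates ρ ∩ F).Nonempty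
  | .coBuchi R, ρ => infStates ρ ∩ R = ∅

/-- Pull an acceptance condition back along a map of states. -/
def Acceptance.comap {P Q : Type*} (f : P → Q) : Acceptance Q → Acceptance P
  | .buchi F => .buchi (f ⁻¹' F)
  | .coBuchi R => .coBuchi (f ⁻¹' R)

/-- A complete ω-automaton with Büchi or co-Büchi acceptance. -/
structure OmegaAutomaton (α Q : Type*) extends TS α Q where
  /-- every state has a successor for every letter -/
  complete : ∀ q a, (δ q a).Nonempty
  /-- the acceptance condition -/
  acc : Acceptance Q

namespace OmegaAutomaton

variable {α Q Q' : Type*}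

/-- `ρ` is a run of `A` on the infinite word `w`. -/
def IsRun (A : OmegaAutomaton α Q) (w : ℕ → α) (ρ : ℕ → Q) : Prop :=
  ρ 0 = A.init ∧ ∀ n, ρ (n + 1) ∈ A.δ (ρ n) (w n)

/-- The ω-language of `A`: the infinite words on which `A` has an accepting run. -/
def language (A : OmegaAutomaton α Q) : Set (ℕ → α) :=
  {w | ∃ ρ, A.IsRun w ρ ∧ A.acc.Sat ρ}

/-- `A` is a deterministic Büchi automaton. -/
def IsDBA (A : OmegaAutomaton α Q) : Prop :=
  A.toTS.IsDeterministic ∧ ∃ F, A.acc = .buchi F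

/-- `A` is a deterministic co-Büchi automaton. -/
def IsDCA (A : OmegaAutomaton α Q) : Prop :=
  A.toTS.IsDeterministic ∧ ∃ R, A.acc = .coBuchi R

/-- `A` is a limit-deterministic Büchi automaton: from every state that can be reached through
an accepting state, there is at most one successor for every letter. -/
def IsLDBA (A : OmegaAutomaton α Q) : Prop :=
  ∃ F, A.acc = .buchi F ∧ ∀ f ∈ F, A.toTS.Reaches A.init f →
    ∀ q, A.toTS.Reaches f q → ∀ a, (A.δ q a).Subsingleton

end OmegaAutomaton

/-! ## Markov decision processes -/

/-- A Markov decision process with states `S`, actions `Act` and state labels in `α`. In state `s`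
exactly the actions in `enabled s` may be taken; `trans s a` is irrelevant for other actions. -/
structure MDP (α S Act : Type*) where
  /-- the initial state -/
  init : S
  /-- the actions that are enabled in a state -/
  enabled : S → Set Act
  enabled_nonempty : ∀ s, (enabled s).Nonempty
  /-- the distribution of the successor state -/
  trans : S → Act → PMF S
  /-- the labelling function -/
  label : S → α

/-- A step of a path: a state together with the action that is taken in it. -/
def Step (S Act : Type*) := S × Act

namespace Step

variable {S Act : Type*}

/-- the state of a step -/
def state (x : Step S Act) : S := x.1

/-- the action of a step -/
def action (x : Step S Act) : Act := x.2

instance : MeasurableSpace (Step S Act) := ⊤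

instance : DiscreteMeasurableSpace (Step S Act) := ⟨fun _ => trivial⟩

instance [Finite S] [Finite Act] : Finite (Step S Act) := inferInstanceAs (Finite (S × Act))

end Step

namespace MDP

variable {α S Act Q : Type*}

/-- A (history-dependent, randomised) strategy. The finite path `s₀ a₀ s₁ a₁ … sₙ` is given by the
list of the steps `(s₀, a₀), …, (sₙ₋₁, aₙ₋₁)` and its last state `sₙ`; the strategy chooses a
distribution over the actions that are enabled in `sₙ`. -/
structure Strategy (M : MDP α S Act) where
  /-- the distribution of the next action after a finite path -/
  choice : List (Step S Act) → S → PMF Act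
  support_subset : ∀ h s, (choice h s).support ⊆ M.enabled s

/-- The distribution of the first step. -/
noncomputable def initPMF (M : MDP α S Act) (σ : M.Strategy) : PMF (Step S Act) :=
  (σ.choice [] M.init).map fun a => (M.init, a)

/-- The distribution of the step that follows the steps `h`, the last of which is `x`. -/
noncomputable def nextPMF (M : MDP α S Act) (σ : M.Strategy) (h : List (Step S Act))
    (x : Step S Act) : PMF (Step S Act) :=
  (M.trans x.state x.action).bind fun s => (σ.choice h s).map fun a => (s, a)

/-- The kernel giving the distribution of step `n + 1` in terms of the steps `0, …, n`. -/
noncomputable def stepKernel [Finite S] [Finite Act] (M : MDP α S Act) (σ : M.Strategy) (n : ℕ) :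
    Kernel (Π _ : Finset.Iic n, Step S Act) (Step S Act) :=
  Kernel.ofFunOfCountable fun x =>
    (M.nextPMF σ
      (List.ofFn fun i : Fin (n + 1) => x ⟨i, Finset.mem_Iic.2 (Nat.lt_succ_iff.1 i.2)⟩)
      (x ⟨n, Finset.mem_Iic.2 le_rfl⟩)).toMeasure

instance [Finite S] [Finite Act] (M : MDP α S Act) (σ : M.Strategy) (n : ℕ) :
    IsMarkovKernel (M.stepKernel σ n) :=
  ⟨fun _ => PMF.toMeasure.isProbabilityMeasure _⟩

/-- The probability measure on infinite paths from the initial state that is induced by `σ`. -/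
noncomputable def pathMeasure [Finite S] [Finite Act] (M : MDP α S Act) (σ : M.Strategy) :
    Measure (ℕ → Step S Act) :=
  Kernel.trajMeasure (X := fun _ => Step S Act) (M.initPMF σ).toMeasure (M.stepKernel σ)

/-- The trace induced by an infinite path. -/
def trace (M : MDP α S Act) (ξ : ℕ → Step S Act) : ℕ → α := fun n => M.label (ξ n).state

/-- The product of an MDP with an automaton: an action of the product is an action of the MDP
together with a successor state of the automaton, which reads the label of the current state. -/
noncomputable def product (M : MDP α S Act) (A : OmegaAutomaton α Q) :
    MDP α (S × Q) (Act × Q) where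
  init := (M.init, A.init)
  enabled x := {b | b.1 ∈ M.enabled x.1 ∧ b.2 ∈ A.δ x.2 (M.label x.1)}
  enabled_nonempty x :=
    let ⟨a, ha⟩ := M.enabled_nonempty x.1
    let ⟨q, hq⟩ := A.complete x.2 (M.label x.1)
    ⟨(a, q), ha, hq⟩
  trans x b := (M.trans x.1 b.1).map fun s => (s, b.2)
  label x := M.label x.1

/-- The maximal semantic satisfaction probability. -/
noncomputable def psem [Finite S] [Finite Act] (M : MDP α S Act) (A : OmegaAutomaton α Q) : ℝ≥0∞ :=
  ⨆ σ : M.Strategy, M.pathMeasure σ {ξ | M.trace ξ ∈ A.language}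

/-- The maximal syntactic satisfaction probability. -/
noncomputable def psyn [Finite S] [Finite Act] [Finite Q] (M : MDP α S Act)
    (A : OmegaAutomaton α Q) : ℝ≥0∞ :=
  ⨆ σ : (M.product A).Strategy,
    (M.product A).pathMeasure σ {ξ | (A.acc.comap Prod.snd).Sat fun n => (ξ n).state}

end MDP

/-- `A` is good for MDPs: for all finite MDPs, the semantic and the syntactic maximal satisfaction
probabilities agree. -/
def OmegaAutomaton.IsGFM {α Q : Type*} [Finite Q] (A : OmegaAutomaton α Q) : Prop :=
  ∀ (S Act : Type) [Finite S] [Finite Act] (M : MDP α S Act), M.psem A = M.psyn A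

/-! ## The AEC-simulation game -/

/-- A transition `(q, a, q')`. -/
abbrev Transition (α Q : Type*) := Q × α × Q

/-- A move of Spoiler: a letter, the target state of a transition over this letter, and possibly
an AEC claim, that is, a collection of finite sequences of transitions. -/
structure SpoilerMove (α Q : Type*) where
  /-- the chosen letter -/
  letter : α
  /-- the state to which the pebble moves -/
  target : Q
  /-- the AEC claim, if one is made with this move -/
  claim : Option (Set (List (Transition α Q)))

namespace AEC

variable {α Q Q' : Type*}

/-- The run of Spoiler in `A`. -/
def spoilerRun (A : OmegaAutomaton α Q) (m : ℕ → SpoilerMove α Q) : ℕ → Q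
  | 0 => A.init
  | n + 1 => (m n).target

/-- The sequence of transitions that Spoiler takes. -/
def spoilerTransitions (A : OmegaAutomaton α Q) (m : ℕ → SpoilerMove α Q) (n : ℕ) :
    Transition α Q :=
  (spoilerRun A m n, (m n).letter, (m n).target)

/-- Spoiler obeys the rules: she moves along transitions of `A`, and makes at most one claim. -/
def LegalSpoiler (A : OmegaAutomaton α Q) (m : ℕ → SpoilerMove α Q) : Prop :=
  A.IsRun (fun n => (m n).letter) (spoilerRun A m) ∧
    ∀ i j, (m i).claim ≠ none → (m j).claim ≠ none → i = j

/-- The finite sequence `u` occurs in the infinite sequence `t` at position `n`. -/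
def OccursAt {β : Type*} (t : ℕ → β) (u : List β) (n : ℕ) : Prop :=
  (List.range u.length).map (fun i => t (n + i)) = u

/-- The infinite sequence of transitions `t` complies with the claim `Λ` that was made together
with the transition `t k`: the non-empty finite sequences in `Λ` are exactly those that occur
infinitely often, and every non-empty finite sequence that occurs after the claim is in `Λ`. -/
def Complies (t : ℕ → Transition α Q) (k : ℕ) (Λ : Set (List (Transition α Q))) : Prop :=
  (∀ u ≠ [], u ∈ Λ ↔ ∃ᶠ n in atTop, OccursAt t u n) ∧
    ∀ u ≠ [], ∀ n > k, OccursAt t u n → u ∈ Λ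

/-- The run of Duplicator in `B` if he uses the strategy `τ`, which maps the moves of Spoiler up to
and including the current round to the next state of Duplicator. -/
def duplicatorRun (B : OmegaAutomaton α Q') (τ : List (SpoilerMove α Q) → Q')
    (m : ℕ → SpoilerMove α Q) : ℕ → Q'
  | 0 => B.init
  | n + 1 => τ ((List.range (n + 1)).map m)

end AEC

open AEC in
/-- `B` AEC-simulates `A`: Duplicator (on `B`) wins the AEC-simulation game against Spoiler
(on `A`), that is, he has a strategy that always obeys the rules (he moves along transitions of `B`
over the letters chosen by Spoiler) and ensures that Spoiler never makes a claim, or the run in `B`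
is accepting, or the run in `A` does not comply with the claim, or the run in `A` is not
accepting. -/
def OmegaAutomaton.AECSimulates {α Q Q' : Type*} (B : OmegaAutomaton α Q')
    (A : OmegaAutomaton α Q) : Prop :=
  ∃ τ : List (SpoilerMove α Q) → Q', ∀ m : ℕ → SpoilerMove α Q, LegalSpoiler A m →
    B.IsRun (fun n => (m n).letter) (duplicatorRun B τ m) ∧
      ((∀ n, (m n).claim = none) ∨
        B.acc.Sat (duplicatorRun B τ m) ∨
        (∃ k Λ, (m k).claim = some Λ ∧ ¬ Complies (spoilerTransitions A m) k Λ) ∨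
        ¬ A.acc.Sat (spoilerRun A m))

/-! ## The automata for the leaf formulas -/

namespace DFA

variable {α Q : Type*}

/-- The transition system of a (complete) DFA. -/
def toTS (D : DFA α Q) : TS α Q := ⟨D.start, fun q a => {D.step q a}⟩

/-- Read a DFA as a Büchi automaton. -/
def readBuchi (D : DFA α Q) : OmegaAutomaton α Q where
  toTS := D.toTS
  complete q a := ⟨D.step q a, rfl⟩
  acc := .buchi D.accept

/-- Read a DFA as a co-Büchi automaton, its final states being the rejecting states. -/
def readCoBuchi (D : DFA α Q) : OmegaAutomaton α Q where
  toTS := D.toTS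
  complete q a := ⟨D.step q a, rfl⟩
  acc := .coBuchi D.accept

open scoped Classical in
/-- Make all final states of a DFA sinks. -/
noncomputable def sinkFinal (D : DFA α Q) : DFA α Q where
  step q a := if q ∈ D.accept then q else D.step q a
  start := D.start
  accept := D.accept

/-- The reachable states of a DFA. -/
def Reachable (D : DFA α Q) (q : Q) : Prop := ∃ w, D.eval w = q

/-- Remove the unreachable states of a DFA. -/
def trim (D : DFA α Q) : DFA α {q // D.Reachable q} where
  step q a := ⟨D.step q a, q.2.elim fun w hw => ⟨w ++ [a], by
    rw [DFA.eval_append_singleton, hw]⟩⟩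
  start := ⟨D.start, [], rfl⟩
  accept := {q | q.1 ∈ D.accept}

/-- The automaton for `∃φ`, where `D` is the DFA for `φ`. -/
noncomputable def existsAut (D : DFA α Q) : OmegaAutomaton α Q := D.sinkFinal.readBuchi

/-- The automaton for `∀φ`, where `C` is the DFA for `¬φ`. -/
noncomputable def forallAut (C : DFA α Q) : OmegaAutomaton α {q // C.sinkFinal.Reachable q} :=
  (C.sinkFinal.trim)ᶜ.readBuchi

/-- The automaton for `∀∃φ`, where `D` is the DFA for `φ`. -/
def forallExistsAut (D : DFA α Q) : OmegaAutomaton α Q := D.readBuchi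

/-- The co-Büchi automaton for `∃∀φ`, where `D` is the DFA for `φ`: complement `D` and read the
result as a co-Büchi automaton. -/
def existsForallDCA (D : DFA α Q) : OmegaAutomaton α Q := (Dᶜ).readCoBuchi

/-- The (incomplete) transition system on `Q × {0, 1}` with the transitions
`δ₀ ⊎ δⱼ ⊎ δ₁` (in this order); here `F = D.accept`, `false` is `0` and `true` is `1`. -/
def jumpTS (D : DFA α Q) : TS α (Q × Bool) where
  init := (D.start, false)
  δ x a := {y |
    (x.2 = false ∧ y.2 = false ∧ D.step x.1 a = y.1) ∨
    (x.2 = false ∧ y.2 = true ∧ y.1 ∈ D.accept ∧ D.step x.1 a = y.1) ∨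
    (x.2 = true ∧ y.2 = true ∧ x.1 ∈ D.accept ∧ y.1 ∈ D.accept ∧ D.step x.1 a = y.1)}

/-- The automaton for `∃∀φ`, where `D` is the DFA for `φ`: the completion of `jumpTS`, with the
accepting states `F × {1}`. -/
noncomputable def existsForallAut (D : DFA α Q) : OmegaAutomaton α (Option (Q × Bool)) where
  toTS := D.jumpTS.completion
  complete := D.jumpTS.completion_nonempty
  acc := .buchi (some '' (D.accept ×ˢ {true}))

end DFA

/-! `Psyn ≤ Psem` holds for every automaton. A product strategy induces an MDP strategy through the
conditional action probabilities given the projected history; both yield the same law on MDP paths,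
and almost every product path carries a run on its trace (`MDP.psyn_le_psem`). Such comparisons of
laws rest on `HasSteps.unique`: one-step conditional probabilities determine the path measure.

For the converse, a rule choosing automaton states from the letters read so far lifts any MDP
strategy to the product (`MDP.pathMeasure_liftStrategy`). No single rule has to succeed on the whole
language: by continuity from below, increasing sets that cover it, each with its own rule, suffice
(`OmegaAutomaton.isGFM_of_resolvers`). Deterministic automata need one rule. For `existsForallAut`,
every accepted word keeps `D` in final states after some time `n`, and "jump at time `n`" is
accepting on all such words.

In the simulation game Duplicator jumps when the claim is made. If Spoiler complies, each later
transition recurs forever; if her run is also accepting, non-final states occur only finitely often.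
Hence every state after the claim is final and Duplicator never falls into the sink. -/

/-! ## Trajectory measures over a countable state space -/

/-- The first `n` entries of an infinite sequence. -/
def initialSegment {β : Type*} (n : ℕ) (ξ : ℕ → β) : List β := (List.range n).map ξ

section Trajectory

variable {β γ : Type*}

@[simp] theorem length_initialSegment (n : ℕ) (ξ : ℕ → β) : (initialSegment n ξ).length = n := by
  simp [initialSegment]

@[simp] theorem initialSegment_zero (ξ : ℕ → β) : initialSegment 0 ξ = [] := rfl

theorem initialSegment_succ (n : ℕ) (ξ : ℕ → β) :
    initialSegment (n + 1) ξ = initialSegment n ξ ++ [ξ n] := by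
  simp [initialSegment, List.range_succ]

theorem initialSegment_eq_iff {n : ℕ} {ξ ζ : ℕ → β} :
    initialSegment n ξ = initialSegment n ζ ↔ ∀ i < n, ξ i = ζ i := by
  simp [initialSegment]

theorem map_initialSegment (f : β → γ) (n : ℕ) (ξ : ℕ → β) :
    (initialSegment n ξ).map f = initialSegment n (f ∘ ξ) := by
  simp [initialSegment]

theorem initialSegment_eq_append_singleton (h : List β) (x : β) (ξ : ℕ → β) :
    initialSegment (h ++ [x]).length ξ = h ++ [x] ↔
      initialSegment h.length ξ = h ∧ ξ h.length = x := by
  have : (h ++ [x]).length = h.length + 1 := by simp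
  rw [this, initialSegment_succ]
  constructor
  · intro e
    obtain ⟨h1, h2⟩ := List.append_inj' e rfl
    exact ⟨h1, by simpa using h2⟩
  · rintro ⟨h1, h2⟩
    rw [h1, h2]

variable [MeasurableSpace β]

/-- `μ` is the law of a process whose next value after the history `h` has distribution `p h`. -/
def HasSteps (p : List β → PMF β) (μ : Measure (ℕ → β)) : Prop :=
  ∀ h x, μ {ξ | initialSegment h.length ξ = h ∧ ξ h.length = x} =
    μ {ξ | initialSegment h.length ξ = h} * p h x

theorem HasSteps.measure_initialSegment_eq {p : List β → PMF β} {μ ν : Measure (ℕ → β)}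
    [IsProbabilityMeasure μ] [IsProbabilityMeasure ν] (hμ : HasSteps p μ) (hν : HasSteps p ν)
    (h : List β) :
    μ {ξ | initialSegment h.length ξ = h} = ν {ξ | initialSegment h.length ξ = h} := by
  induction h using List.reverseRecOn with
  | nil => simp
  | append_singleton h x ih =>
    simp only [initialSegment_eq_append_singleton]
    rw [hμ, hν, ih]

/-- There are only countably many pairs of a history and an impossible next value, and each gives a
null event. This later makes paths legal almost surely. -/
theorem HasSteps.ae_ne_zero [Countable β] {p : List β → PMF β} {μ : Measure (ℕ → β)}
    (hμ : HasSteps p μ) : ∀ᵐ ξ ∂μ, ∀ n, p (initialSegment n ξ) (ξ n) ≠ 0 := by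
  rw [ae_all_iff]
  intro n
  have : ∀ hx : {hx : List β × β // p hx.1 hx.2 = 0},
      ∀ᵐ ξ ∂μ, ¬ (initialSegment hx.1.1.length ξ = hx.1.1 ∧ ξ hx.1.1.length = hx.1.2) := by
    rintro ⟨⟨h, x⟩, hx⟩
    rw [ae_iff]
    simp only [not_not]
    rw [hμ, hx, mul_zero]
  filter_upwards [ae_all_iff.2 this] with ξ hξ h0
  exact hξ ⟨(initialSegment n ξ, ξ n), h0⟩ (by simp)

variable [Countable β] [DiscreteMeasurableSpace β]

theorem measurableSet_initialSegment (n : ℕ) (H : Set (List β)) :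
    MeasurableSet {ξ : ℕ → β | initialSegment n ξ ∈ H} := by
  have h : Measurable fun (ξ : ℕ → β) (i : Fin n) => ξ i := by fun_prop
  have : {ξ : ℕ → β | initialSegment n ξ ∈ H} =
      (fun (ξ : ℕ → β) (i : Fin n) => ξ i) ⁻¹' {x | List.ofFn x ∈ H} := by
    ext ξ
    have : initialSegment n ξ = List.ofFn fun i : Fin n => ξ i := by
      apply List.ext_getElem <;> simp [initialSegment]
    simp [this]
  rw [this]
  exact h (MeasurableSet.of_discrete)

/-- Restricting `μ` to `E` leaves a sum over countably many measurable fibres of `initialSegment n`,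
so `E` itself may be arbitrary. -/
theorem measure_initialSegment_mem (μ : Measure (ℕ → β)) (n : ℕ) (H : Set (List β))
    (E : Set (ℕ → β)) :
    μ {ξ | initialSegment n ξ ∈ H ∧ ξ ∈ E} =
      ∑' h : H, μ {ξ | initialSegment n ξ = h ∧ ξ ∈ E} := by
  have := tsum_measure_preimage_singleton (μ := μ.restrict E) (Set.to_countable H)
    (f := initialSegment n) (fun y _ => measurableSet_initialSegment n {y})
  refine Eq.trans ?_ (this.symm.trans (tsum_congr fun y => ?_))
  · exact (Measure.restrict_apply (measurableSet_initialSegment n H)).symm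
  · refine (Measure.restrict_apply (measurableSet_initialSegment n {y.1})).trans ?_
    rfl

/-- Cylinders form a generating π-system. Each depends on finitely many coordinates, so it is a
countable disjoint union of initial-segment events, whose probabilities `p` determines. -/
theorem HasSteps.unique {p : List β → PMF β} {μ ν : Measure (ℕ → β)}
    [IsProbabilityMeasure μ] [IsProbabilityMeasure ν] (hμ : HasSteps p μ) (hν : HasSteps p ν) :
    μ = ν := by
  refine ext_of_generate_finite (measurableCylinders fun _ : ℕ => β)
    generateFrom_measurableCylinders.symm isPiSystem_measurableCylinders ?_ (by simp)
  intro s hs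
  obtain ⟨t, T, -, rfl⟩ := (mem_measurableCylinders s).1 hs
  obtain ⟨n, hn⟩ : ∃ n, ∀ i ∈ t, i < n :=
    ⟨t.sup id + 1, fun i hi => Nat.lt_succ_of_le (Finset.le_sup (f := id) hi)⟩
  have key : (cylinder t T : Set (ℕ → β)) = {ξ | initialSegment n ξ ∈
      initialSegment n '' (cylinder t T : Set (ℕ → β)) ∧ ξ ∈ Set.univ} := by
    ext ξ
    simp only [Set.mem_univ, and_true, Set.mem_ofPred_eq]
    refine ⟨fun h => ⟨ξ, h, rfl⟩, ?_⟩
    rintro ⟨ζ, hζ, h⟩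
    rw [mem_cylinder] at hζ ⊢
    convert hζ using 1
    ext i
    exact (initialSegment_eq_iff.1 h i (hn i i.2)).symm
  rw [key, measure_initialSegment_mem _ _ _ Set.univ, measure_initialSegment_mem _ _ _ Set.univ]
  refine tsum_congr ?_
  rintro ⟨_, ξ, -, rfl⟩
  simpa using hμ.measure_initialSegment_eq hν (initialSegment n ξ)

theorem HasSteps.measure_initialSegment_inter {p : List β → PMF β} {μ : Measure (ℕ → β)}
    (hμ : HasSteps p μ) (h : List β) (T : Set β) :
    μ {ξ | initialSegment h.length ξ = h ∧ ξ h.length ∈ T} =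
      μ {ξ | initialSegment h.length ξ = h} * (p h).toMeasure T := by
  have h1 : ((μ.restrict {ξ | initialSegment h.length ξ = h}).map fun ξ => ξ h.length) =
      μ {ξ | initialSegment h.length ξ = h} • (p h).toMeasure := by
    rw [Measure.ext_iff_singleton]
    intro x
    rw [Measure.map_apply (by fun_prop) (by simp),
      Measure.restrict_apply (measurable_pi_apply _ (by simp)),
      Measure.smul_apply, PMF.toMeasure_apply_singleton _ _ (by simp), smul_eq_mul, ← hμ,
      Set.inter_comm]
    rfl
  have h2 := congrArg (fun ν => ν T) h1
  simp only [Measure.smul_apply, smul_eq_mul] at h2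
  rw [← h2, Measure.map_apply (by fun_prop) .of_discrete,
    Measure.restrict_apply (measurable_pi_apply _ .of_discrete), Set.inter_comm]
  rfl

/-- Intended for `H` consisting of all product histories above one MDP history: they differ as
histories but give `T` the same conditional probability. -/
theorem HasSteps.measure_mem_inter {p : List β → PMF β} {μ : Measure (ℕ → β)}
    (hμ : HasSteps p μ) (n : ℕ) (H : Set (List β)) (T : Set β) (c : ℝ≥0∞)
    (hc : ∀ h ∈ H, h.length = n → (p h).toMeasure T = c) :
    μ {ξ | initialSegment n ξ ∈ H ∧ ξ n ∈ T} = μ {ξ | initialSegment n ξ ∈ H} * c := by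
  have h1 := measure_initialSegment_mem μ n H {ξ | ξ n ∈ T}
  have h2 := measure_initialSegment_mem μ n H Set.univ
  simp only [Set.mem_ofPred_eq, Set.mem_univ, and_true] at h1 h2
  rw [h1, h2, ← ENNReal.tsum_mul_right]
  refine tsum_congr fun ⟨h, hh⟩ => ?_
  by_cases hn : h.length = n
  · subst hn
    rw [← hc h hh rfl]
    exact hμ.measure_initialSegment_inter h T
  · have : ∀ ξ : ℕ → β, initialSegment n ξ ≠ h := fun ξ e => hn (by simp [← e])
    simp [this]

/-- The process obtained by replacing every value by a function of this value and the history. -/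
def decorate (e : List β → β → γ) (ξ : ℕ → β) (n : ℕ) : γ := e (initialSegment n ξ) (ξ n)

theorem measurable_decorate [MeasurableSpace γ] (e : List β → β → γ) :
    Measurable (decorate e) := by
  refine measurable_pi_iff.2 fun n s _ => ?_
  convert measurableSet_initialSegment (n + 1)
    {l : List β | ∃ h x, l = h ++ [x] ∧ e h x ∈ s} using 1
  ext ξ
  simp [initialSegment_succ, decorate]

/-- Since `π` undoes the decoration, a decorated history determines the original one, and the
next-step law is simply pushed forward. Only attainable histories matter, so `hp` constrains `p'` on
these alone. -/
theorem HasSteps.map_decorate [Countable γ] [MeasurableSpace γ] [DiscreteMeasurableSpace γ]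
    {p : List β → PMF β} {μ : Measure (ℕ → β)} (hμ : HasSteps p μ) (e : List β → β → γ)
    (π : γ → β) (hπ : ∀ h x, π (e h x) = x) (p' : List γ → PMF γ)
    (hp : ∀ n ξ, p' (initialSegment n (decorate e ξ)) =
      (p (initialSegment n ξ)).map (e (initialSegment n ξ))) :
    HasSteps p' (μ.map (decorate e)) := by
  intro h' y
  have m1 : MeasurableSet {ζ : ℕ → γ | initialSegment h'.length ζ = h'} :=
    measurableSet_initialSegment _ {h'}
  have m2 : MeasurableSet {ζ : ℕ → γ | ζ h'.length = y} :=
    (measurable_pi_apply h'.length : Measurable fun ζ : ℕ → γ => ζ h'.length)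
      (MeasurableSet.singleton y)
  have m12 : MeasurableSet {ζ : ℕ → γ | initialSegment h'.length ζ = h' ∧ ζ h'.length = y} :=
    m1.inter m2
  rw [Measure.map_apply (measurable_decorate e) m12,
    Measure.map_apply (measurable_decorate e) m1]
  simp only [Set.preimage_ofPred_eq]
  by_cases hex : ∃ ξ, initialSegment h'.length (decorate e ξ) = h'
  · obtain ⟨ξ₀, hξ₀⟩ := hex
    generalize h'.length = n at *
    subst hξ₀
    have key : ∀ ξ, initialSegment n (decorate e ξ) = initialSegment n (decorate e ξ₀) ↔
        initialSegment n ξ = initialSegment n ξ₀ := by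
      intro ξ
      constructor
      · intro h
        have := congrArg (List.map π) h
        have hid : ∀ ζ, π ∘ decorate e ζ = ζ := fun ζ => funext fun i => hπ _ _
        simpa [map_initialSegment, hid] using this
      · intro h
        rw [initialSegment_eq_iff] at h ⊢
        intro i hi
        have : initialSegment i ξ = initialSegment i ξ₀ :=
          initialSegment_eq_iff.2 fun j hj => h j (hj.trans hi)
        simp [decorate, this, h i hi]
    have h1 := hμ.measure_initialSegment_inter (initialSegment n ξ₀)
      (e (initialSegment n ξ₀) ⁻¹' {y})
    rw [length_initialSegment] at h1
    rw [hp, ← PMF.toMeasure_apply_singleton _ _ (by simp),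
      PMF.toMeasure_map_apply _ _ _ (by fun_prop) (by simp)]
    simp only [key]
    rw [← h1]
    congr 1
    ext ξ
    simp only [Set.mem_preimage, Set.mem_ofPred_eq, Set.mem_singleton_iff]
    refine and_congr_right fun h => ?_
    simp [decorate, h]
  -- A history that is no decoration has probability zero, so both sides vanish.
  · push Not at hex
    simp [hex]

end Trajectory

/-! ### One-step laws of MDP paths. -/

namespace Step

variable {S Act : Type*}

/-- The step that takes the action `a` in the state `s`. -/
def mk (s : S) (a : Act) : Step S Act := (s, a)

@[simp] theorem mk_state_action (x : Step S Act) : mk x.state x.action = x := rfl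

end Step

namespace MDP

variable {α S Act Q : Type*}

/-- The distribution of the state that is reached after the given steps. -/
noncomputable def statePMF (M : MDP α S Act) (h : List (Step S Act)) : PMF S :=
  match h.getLast? with
  | none => PMF.pure M.init
  | some x => M.trans x.state x.action

/-- The distribution of the step that follows the given steps. -/
noncomputable def stepPMF (M : MDP α S Act) (σ : M.Strategy) (h : List (Step S Act)) :
    PMF (Step S Act) :=
  (M.statePMF h).bind fun s => (σ.choice h s).map (Step.mk s)

theorem stepPMF_apply (M : MDP α S Act) (σ : M.Strategy) (h : List (Step S Act))
    (x : Step S Act) :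
    M.stepPMF σ h x = M.statePMF h x.state * σ.choice h x.state x.action := by
  classical
  rw [stepPMF, PMF.bind_apply, tsum_eq_single x.state]
  · rw [PMF.map_apply, tsum_eq_single x.action]
    · rw [Step.mk_state_action, if_pos rfl]
    · intro a ha
      rw [if_neg]
      exact fun e => ha (congrArg Step.action e).symm
  · intro s hs
    have : PMF.map (Step.mk s) (σ.choice h s) x = 0 := by
      rw [PMF.apply_eq_zero_iff, PMF.support_map]
      rintro ⟨a, -, rfl⟩
      exact hs rfl
    rw [this, mul_zero]

theorem map_state_stepPMF (M : MDP α S Act) (σ : M.Strategy) (h : List (Step S Act)) :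
    (M.stepPMF σ h).map Step.state = M.statePMF h := by
  have : ∀ s : S, Step.state ∘ (Step.mk s : Act → _) = Function.const Act s := fun s => rfl
  simp only [stepPMF, PMF.map_bind, PMF.map_comp, this, PMF.map_const]
  exact PMF.bind_pure _

theorem stepPMF_nil (M : MDP α S Act) (σ : M.Strategy) : M.stepPMF σ [] = M.initPMF σ :=
  PMF.pure_bind _ _

theorem stepPMF_append_singleton (M : MDP α S Act) (σ : M.Strategy) (h : List (Step S Act))
    (x : Step S Act) : M.stepPMF σ (h ++ [x]) = M.nextPMF σ (h ++ [x]) x := by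
  simp only [stepPMF, statePMF, nextPMF, List.getLast?_concat]
  rfl

section Measure

variable [Finite S] [Finite Act]

instance (M : MDP α S Act) (σ : M.Strategy) : IsProbabilityMeasure (M.pathMeasure σ) := by
  unfold pathMeasure
  infer_instance

theorem map_zero_pathMeasure (M : MDP α S Act) (σ : M.Strategy) :
    (M.pathMeasure σ).map (fun ξ => ξ 0) = (M.initPMF σ).toMeasure := by
  have h : (fun ξ : ℕ → Step S Act => ξ 0) =
      (MeasurableEquiv.piUnique fun _ : Finset.Iic 0 => Step S Act) ∘
        Preorder.frestrictLe (π := fun _ => Step S Act) 0 := by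
    ext ξ
    rfl
  rw [h, ← Measure.map_map (by fun_prop) (by fun_prop), pathMeasure, Kernel.trajMeasure,
    Measure.map_comp _ _ (by fun_prop), Kernel.traj_map_frestrictLe, Kernel.partialTraj_self,
    Measure.id_comp, Measure.map_map (by fun_prop) (by fun_prop), MeasurableEquiv.self_comp_symm,
    Measure.map_id]

/-- For a non-empty history this is the composition-product identity for trajectory measures,
evaluated on a singleton rectangle; the rest translates between lists and functions on `Finset.Iic
n`. -/
theorem hasSteps_pathMeasure (M : MDP α S Act) (σ : M.Strategy) :
    HasSteps (M.stepPMF σ) (M.pathMeasure σ) := by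
  intro h x
  rcases h.eq_nil_or_concat' with rfl | ⟨h, y, rfl⟩
  · have := congrArg (fun ν => ν {x}) (M.map_zero_pathMeasure σ)
    simp only [PMF.toMeasure_apply_singleton _ _ (MeasurableSet.singleton x)] at this
    rw [Measure.map_apply (by fun_prop) (by simp)] at this
    simpa [stepPMF_nil, Set.preimage] using this
  · rw [stepPMF_append_singleton]
    set n := h.length with hn
    have hlen : (h ++ [y]).length = n + 1 := by simp [hn]
    have key := Kernel.map_frestrictLe_trajMeasure_compProd_eq_map_trajMeasure
      (X := fun _ => Step S Act) (μ₀ := (M.initPMF σ).toMeasure) (κ := M.stepKernel σ) (a := n)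
    let u : (Π _ : Finset.Iic n, Step S Act) := fun i =>
      (h ++ [y]).get ⟨i, by rw [hlen]; exact Nat.lt_succ_iff.2 (Finset.mem_Iic.1 i.2)⟩
    have hu : (List.ofFn fun i : Fin (n + 1) =>
        u ⟨i, Finset.mem_Iic.2 (Nat.lt_succ_iff.1 i.2)⟩) = h ++ [y] := by
      apply List.ext_getElem
      · simp [hn, -List.ofFn_succ]
      · intro i h1 h2
        simp [u, -List.ofFn_succ]
    have huy : u ⟨n, Finset.mem_Iic.2 le_rfl⟩ = y := by simp [u, hn]
    have hκ : M.stepKernel σ n u = (M.nextPMF σ (h ++ [y]) y).toMeasure := by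
      change (M.nextPMF σ _ _).toMeasure = _
      rw [hu, huy]
    have hseg : ∀ ξ : ℕ → Step S Act,
        initialSegment (n + 1) ξ = h ++ [y] ↔
          Preorder.frestrictLe (π := fun _ => Step S Act) n ξ = u := by
      intro ξ
      rw [← hu]
      constructor
      · intro e
        ext1 i
        have h1 : i.1 < n + 1 := Nat.lt_succ_iff.2 (Finset.mem_Iic.1 i.2)
        have := List.getElem_of_eq e (i := i) (by simpa using h1)
        simpa [initialSegment, -List.ofFn_succ] using this
      · intro e
        apply List.ext_getElem
        · simp [-List.ofFn_succ]
        · intro i h1 h2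
          simp [← e, initialSegment, -List.ofFn_succ]
    have key2 := congrArg (fun ν => ν ({u} ×ˢ {x})) key
    rw [Measure.compProd_apply_prod (by simp) (by simp), lintegral_singleton, hκ,
      PMF.toMeasure_apply_singleton _ _ (by simp),
      Measure.map_apply (by fun_prop) (by simp),
      Measure.map_apply (by fun_prop)
        ((MeasurableSet.singleton u).prod (MeasurableSet.singleton x))] at key2
    rw [hlen]
    simp only [hseg]
    rw [mul_comm] at key2
    exact key2.symm

end Measure

end MDP

/-! ### Acceptance in terms of visiting times. -/

section Acceptance

variable {P Q : Type*} [Finite Q]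

/-- Finiteness of `Q` enters by pigeonhole: infinitely many visits to `F` repeat some state of `F`
infinitely often. -/
theorem Acceptance.sat_buchi_iff (F : Set Q) (ρ : ℕ → Q) :
    (Acceptance.buchi F).Sat ρ ↔ ∃ᶠ n in atTop, ρ n ∈ F := by
  constructor
  · rintro ⟨q, hq, hF⟩
    exact Frequently.mono hq fun n hn => hn ▸ hF
  · intro h
    by_contra hne
    refine h ?_
    have : ∀ q : Q, ∀ᶠ n in atTop, q ∈ F → ρ n ≠ q := by
      intro q
      by_cases hq : q ∈ F
      · have : q ∉ infStates ρ := fun hi => hne ⟨q, hi, hq⟩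
        filter_upwards [not_frequently.1 this] with n hn _ using hn
      · exact Eventually.of_forall fun n h => absurd h hq
    filter_upwards [eventually_all.2 this] with n hn hF
    exact hn _ hF rfl

theorem Acceptance.sat_coBuchi_iff (R : Set Q) (ρ : ℕ → Q) :
    (Acceptance.coBuchi R).Sat ρ ↔ ∀ᶠ n in atTop, ρ n ∉ R := by
  have h := Acceptance.sat_buchi_iff R ρ
  rw [← not_iff_not, not_eventually]
  simp only [not_not]
  rw [← h]
  exact Set.nonempty_iff_ne_empty.symm

theorem Acceptance.sat_comap_iff [Finite P] (acc : Acceptance Q) (f : P → Q) (ρ : ℕ → P) :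
    (acc.comap f).Sat ρ ↔ acc.Sat fun n => f (ρ n) := by
  cases acc with
  | buchi F => rw [Acceptance.comap, sat_buchi_iff, sat_buchi_iff]; rfl
  | coBuchi R => rw [Acceptance.comap, sat_coBuchi_iff, sat_coBuchi_iff]; rfl

end Acceptance

/-! ### `Psyn ≤ Psem`: projecting product strategies. -/

namespace MDP

variable {α S Act Q : Type*}

theorem ae_pathMeasure_legal [Finite S] [Finite Act] (M : MDP α S Act) (σ : M.Strategy) :
    ∀ᵐ ξ ∂M.pathMeasure σ, (ξ 0).state = M.init ∧ ∀ n, (ξ n).action ∈ M.enabled (ξ n).state ∧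
      (ξ (n + 1)).state ∈ (M.trans (ξ n).state (ξ n).action).support := by
  filter_upwards [(M.hasSteps_pathMeasure σ).ae_ne_zero] with ξ hξ
  simp only [stepPMF_apply, mul_ne_zero_iff] at hξ
  refine ⟨?_, fun n => ⟨σ.support_subset _ _ (hξ n).2, ?_⟩⟩
  · have h := (hξ 0).1
    rw [← PMF.mem_support_iff] at h
    simpa [statePMF] using h
  · have h := (hξ (n + 1)).1
    simpa [initialSegment_succ, statePMF] using h

/-- The step of the MDP that underlies a step of a product. -/
def projStep (y : Step (S × Q) (Act × Q)) : Step S Act := Step.mk y.state.1 y.action.1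

theorem measurable_projStep :
    Measurable fun (ξ : ℕ → Step (S × Q) (Act × Q)) (n : ℕ) => projStep (ξ n) :=
  measurable_pi_iff.2 fun n => Measurable.comp (g := projStep) .of_discrete (measurable_pi_apply n)

theorem map_fst_statePMF_product (M : MDP α S Act) (A : OmegaAutomaton α Q)
    (h : List (Step (S × Q) (Act × Q))) :
    ((M.product A).statePMF h).map Prod.fst = M.statePMF (h.map projStep) := by
  rcases h.eq_nil_or_concat' with rfl | ⟨h, y, rfl⟩
  · exact PMF.pure_map _ _
  · simp only [statePMF, List.map_append, List.map_cons, List.map_nil, List.getLast?_concat]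
    exact (PMF.map_comp _ _ _).trans (PMF.map_id _)

section Projection

variable [Finite S] [Finite Act] [Finite Q] {M : MDP α S Act} {A : OmegaAutomaton α Q}

/-- The law of the underlying path of the MDP when a strategy of a product is used. -/
noncomputable def projMeasure (σ : (M.product A).Strategy) : Measure (ℕ → Step S Act) :=
  ((M.product A).pathMeasure σ).map fun ξ n => projStep (ξ n)

instance (σ : (M.product A).Strategy) : IsProbabilityMeasure (projMeasure σ) :=
  Measure.isProbabilityMeasure_map measurable_projStep.aemeasurable

/-- The automaton component does not influence the next MDP state, so all product histories above
`h` agree on its law. The sum is the normalising constant in `projStrategy`. -/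
theorem tsum_projMeasure_step (σ : (M.product A).Strategy) (h : List (Step S Act)) (s : S) :
    ∑' a, projMeasure σ {ξ | initialSegment h.length ξ = h ∧ ξ h.length = Step.mk s a} =
      projMeasure σ {ξ | initialSegment h.length ξ = h} * M.statePMF h s := by
  have m0 : MeasurableSet {ξ : ℕ → Step S Act | initialSegment h.length ξ = h} :=
    measurableSet_initialSegment _ {h}
  have m1 : ∀ T : Set (Step S Act), MeasurableSet {ξ : ℕ → Step S Act | ξ h.length ∈ T} :=
    fun T => (measurable_pi_apply h.length : Measurable fun ξ : ℕ → Step S Act => ξ h.length)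
      (MeasurableSet.of_discrete (s := T))
  have m2 : MeasurableSet {ξ : ℕ → Step S Act |
      initialSegment h.length ξ = h ∧ ξ h.length ∈ {x | x.state = s}} := by
    have := m1 {x | x.state = s}
    exact m0.inter this
  have h1 : ∑' a, projMeasure σ {ξ | initialSegment h.length ξ = h ∧ ξ h.length = Step.mk s a} =
      projMeasure σ {ξ | initialSegment h.length ξ = h ∧ ξ h.length ∈ {x | x.state = s}} := by
    rw [← measure_iUnion]
    · congr 1
      ext ξ
      simp only [Set.mem_iUnion, Set.mem_ofPred_eq, exists_and_left]
      refine and_congr_right fun _ => ⟨fun ⟨a, ha⟩ => by rw [ha]; rfl, fun hs => ?_⟩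
      exact ⟨(ξ h.length).action, by rw [← hs]; rfl⟩
    · intro a b hab
      refine Set.disjoint_left.2 fun ξ ha hb => hab ?_
      exact congrArg Step.action (ha.2.symm.trans hb.2)
    · intro a
      have : MeasurableSet {ξ : ℕ → Step S Act | ξ h.length ∈ ({Step.mk s a} : Set _)} := m1 _
      exact m0.inter this
  rw [h1, projMeasure, Measure.map_apply measurable_projStep m2,
    Measure.map_apply measurable_projStep m0]
  have h2 := ((M.product A).hasSteps_pathMeasure σ).measure_mem_inter h.length
    {h' | h'.map projStep = h} {y | y.state.1 = s} (M.statePMF h s) ?_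
  · simp only [Set.mem_ofPred_eq, map_initialSegment] at h2
    exact h2
  · rintro h' rfl -
    rw [PMF.toMeasure_apply_eq_toOuterMeasure, ← map_fst_statePMF_product M A,
      ← map_state_stepPMF _ σ, PMF.map_comp, ← PMF.toOuterMeasure_apply_singleton,
      PMF.toOuterMeasure_map_apply]
    rfl

open scoped Classical in
/-- The strategy of the MDP that chooses actions according to their conditional probability given
the path of the MDP, when a given strategy of a product is used. -/
noncomputable def projStrategy (σ : (M.product A).Strategy) : M.Strategy where
  choice h s :=
    -- If the finite path has probability zero there is nothing to condition on, and any enabled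
    -- action will do.
    if hz : ∑' a, projMeasure σ
        {ξ | initialSegment h.length ξ = h ∧ ξ h.length = Step.mk s a} = 0 then
      PMF.pure (M.enabled_nonempty s).some
    else
      PMF.normalize (fun a => projMeasure σ
        {ξ | initialSegment h.length ξ = h ∧ ξ h.length = Step.mk s a}) hz
        (by
          rw [tsum_projMeasure_step]
          exact ENNReal.mul_ne_top (measure_ne_top _ _) (PMF.apply_ne_top _ _))
  support_subset h s := by
    intro a ha
    split_ifs at ha with hz
    · rw [PMF.support_pure, Set.mem_singleton_iff] at ha
      exact ha ▸ (M.enabled_nonempty s).some_mem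
    · rw [PMF.mem_support_normalize_iff] at ha
      -- A disabled action has weight zero, because product paths almost surely take enabled
      -- actions.
      by_contra hne
      refine ha (measure_mono_null (t := {ξ | ξ h.length = Step.mk s a}) (fun ξ hξ => hξ.2) ?_)
      have m1 : MeasurableSet {ξ : ℕ → Step S Act | ξ h.length = Step.mk s a} :=
        (measurable_pi_apply h.length : Measurable fun ξ : ℕ → Step S Act => ξ h.length)
          (MeasurableSet.singleton (Step.mk s a))
      rw [projMeasure, Measure.map_apply measurable_projStep m1]
      refine measure_mono_null (t := {ξ | ¬ _}) ?_ ((M.product A).ae_pathMeasure_legal σ)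
      intro ξ hξ hleg
      have h1 : projStep (ξ h.length) = Step.mk s a := hξ
      have h2 := (hleg.2 h.length).1.1
      refine hne ?_
      have e1 : (ξ h.length).state.1 = s := congrArg Step.state h1
      have e2 : (ξ h.length).action.1 = a := congrArg Step.action h1
      rwa [e1, e2] at h2

/-- The normalising constant cancels against the probability of reaching the state; where it is
zero, so is every summand. -/
theorem pathMeasure_projStrategy (σ : (M.product A).Strategy) :
    M.pathMeasure (projStrategy σ) = projMeasure σ := by
  refine (M.hasSteps_pathMeasure _).unique fun h x => ?_
  rw [stepPMF_apply, ← mul_assoc, ← tsum_projMeasure_step]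
  simp only [projStrategy]
  split_ifs with hz
  · rw [hz, zero_mul]
    exact ENNReal.tsum_eq_zero.1 hz x.action
  · rw [PMF.normalize_apply, mul_left_comm, ENNReal.mul_inv_cancel hz, mul_one]
    · rfl
    · rw [tsum_projMeasure_step]
      exact ENNReal.mul_ne_top (measure_ne_top _ _) (PMF.apply_ne_top _ _)

theorem psyn_le_psem (M : MDP α S Act) (A : OmegaAutomaton α Q) : M.psyn A ≤ M.psem A := by
  refine iSup_le fun σ => le_iSup_of_le (projStrategy σ) ?_
  rw [pathMeasure_projStrategy, projMeasure]
  -- This inequality holds for arbitrary sets, so measurability of the ω-language is not needed.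
  refine le_trans ?_ (Measure.le_map_apply measurable_projStep.aemeasurable _)
  refine measure_mono_ae ?_
  filter_upwards [(M.product A).ae_pathMeasure_legal σ] with ξ hleg hsat
  refine ⟨fun n => (ξ n).state.2, ⟨congrArg Prod.snd hleg.1, fun n => ?_⟩,
    (Acceptance.sat_comap_iff _ _ _).1 hsat⟩
  have h1 := (hleg.2 n).1.2
  have h2 := (hleg.2 n).2
  obtain ⟨s, -, hs⟩ := (PMF.mem_support_map_iff _ _ _).1 h2
  change (ξ (n + 1)).state.2 ∈ _
  rw [← hs]
  exact h1

end Projection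

end MDP

/-! ### `Psem ≤ Psyn`: lifting strategies along resolvers. -/

/-- A rule that resolves the nondeterminism of an automaton:
`f u` is the state after reading `u`. -/
def OmegaAutomaton.IsResolver {α Q : Type*} (A : OmegaAutomaton α Q) (f : List α → Q) : Prop :=
  f [] = A.init ∧ ∀ u a, f (u ++ [a]) ∈ A.δ (f u) a

theorem OmegaAutomaton.IsResolver.isRun {α Q : Type*} {A : OmegaAutomaton α Q} {f : List α → Q}
    (hf : A.IsResolver f) (w : ℕ → α) : A.IsRun w fun n => f (initialSegment n w) :=
  ⟨hf.1, fun n => by simpa only [initialSegment_succ] using hf.2 _ _⟩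

namespace MDP

variable {α S Act Q : Type*}

/-- The finite trace of a list of steps. -/
def stepTrace (M : MDP α S Act) (h : List (Step S Act)) : List α := h.map fun x => M.label x.state

theorem stepTrace_append_singleton (M : MDP α S Act) (h : List (Step S Act)) (x : Step S Act) :
    M.stepTrace (h ++ [x]) = M.stepTrace h ++ [M.label x.state] := by
  simp [stepTrace]

theorem stepTrace_initialSegment (M : MDP α S Act) (n : ℕ) (ξ : ℕ → Step S Act) :
    M.stepTrace (initialSegment n ξ) = initialSegment n (M.trace ξ) :=
  map_initialSegment _ _ _

/-- Add the automaton states given by a resolver to a step of an MDP. -/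
def liftStep (M : MDP α S Act) (f : List α → Q) (h : List (Step S Act)) (x : Step S Act) :
    Step (S × Q) (Act × Q) :=
  Step.mk (x.state, f (M.stepTrace h)) (x.action, f (M.stepTrace h ++ [M.label x.state]))

open scoped Classical in
/-- The successor that a resolver prescribes after reading `u`, if this is possible. -/
noncomputable def resolvedSucc (A : OmegaAutomaton α Q) (f : List α → Q) (u : List α) (q : Q)
    (a : α) : Q :=
  if f (u ++ [a]) ∈ A.δ q a then f (u ++ [a]) else (A.complete q a).some

theorem resolvedSucc_mem (A : OmegaAutomaton α Q) (f : List α → Q) (u : List α) (q : Q) (a : α) :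
    resolvedSucc A f u q a ∈ A.δ q a := by
  unfold resolvedSucc
  split_ifs with h
  · exact h
  · exact (A.complete q a).some_mem

theorem resolvedSucc_eq {A : OmegaAutomaton α Q} {f : List α → Q} (hf : A.IsResolver f)
    (u : List α) (a : α) : resolvedSucc A f u (f u) a = f (u ++ [a]) :=
  if_pos (hf.2 _ _)

/-- The strategy of a product that follows a strategy of the MDP and a resolver. -/
noncomputable def liftStrategy {M : MDP α S Act} (σ : M.Strategy) (A : OmegaAutomaton α Q)
    (f : List α → Q) : (M.product A).Strategy where
  choice h y := (σ.choice (h.map projStep) y.1).map fun a =>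
    (a, resolvedSucc A f (M.stepTrace (h.map projStep)) y.2 (M.label y.1))
  support_subset h y := by
    intro b hb
    obtain ⟨a, ha, rfl⟩ := (PMF.mem_support_map_iff _ _ _).1 hb
    exact ⟨σ.support_subset _ _ ha, resolvedSucc_mem _ _ _ _ _⟩

variable {M : MDP α S Act} {A : OmegaAutomaton α Q} {f : List α → Q}

theorem map_projStep_initialSegment_decorate (n : ℕ) (ξ : ℕ → Step S Act) :
    (initialSegment n (decorate (M.liftStep f) ξ)).map projStep = initialSegment n ξ := by
  rw [map_initialSegment]
  rfl

theorem statePMF_product_decorate (hf : A.IsResolver f) (n : ℕ) (ξ : ℕ → Step S Act) :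
    (M.product A).statePMF (initialSegment n (decorate (M.liftStep f) ξ)) =
      (M.statePMF (initialSegment n ξ)).map fun s =>
        (s, f (M.stepTrace (initialSegment n ξ))) := by
  cases n with
  | zero =>
    refine Eq.trans ?_ (PMF.pure_map _ _).symm
    simp only [stepTrace, initialSegment_zero, List.map_nil, hf.1]
    rfl
  | succ n =>
    simp only [initialSegment_succ, statePMF, List.getLast?_concat, stepTrace_append_singleton]
    rfl

/-- On decorated histories the automaton state is the one the resolver prescribes, so the fallback
in `resolvedSucc` is never used. -/
theorem stepPMF_liftStrategy (hf : A.IsResolver f) (σ : M.Strategy) (n : ℕ)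
    (ξ : ℕ → Step S Act) :
    (M.product A).stepPMF (liftStrategy σ A f) (initialSegment n (decorate (M.liftStep f) ξ)) =
      (M.stepPMF σ (initialSegment n ξ)).map (M.liftStep f (initialSegment n ξ)) := by
  rw [stepPMF, statePMF_product_decorate hf, PMF.bind_map, stepPMF, PMF.map_bind]
  congr 1
  funext s
  simp only [Function.comp_apply, liftStrategy, map_projStep_initialSegment_decorate,
    PMF.map_comp, resolvedSucc_eq hf]
  rfl

theorem pathMeasure_liftStrategy [Finite S] [Finite Act] [Finite Q] (hf : A.IsResolver f)
    (σ : M.Strategy) : (M.product A).pathMeasure (liftStrategy σ A f) =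
      (M.pathMeasure σ).map (decorate (M.liftStep f)) := by
  have : IsProbabilityMeasure ((M.pathMeasure σ).map (decorate (M.liftStep f))) :=
    Measure.isProbabilityMeasure_map (measurable_decorate _).aemeasurable
  exact (hasSteps_pathMeasure _ _).unique ((M.hasSteps_pathMeasure σ).map_decorate (M.liftStep f)
    projStep (fun _ _ => rfl) _ (stepPMF_liftStrategy hf σ))

theorem pathMeasure_le_psyn [Finite S] [Finite Act] [Finite Q] (hf : A.IsResolver f)
    (σ : M.Strategy) (E : Set (ℕ → α))
    (hE : ∀ w ∈ E, A.acc.Sat fun n => f (initialSegment n w)) :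
    M.pathMeasure σ {ξ | M.trace ξ ∈ E} ≤ M.psyn A := by
  refine le_iSup_of_le (liftStrategy σ A f) ?_
  rw [pathMeasure_liftStrategy hf]
  refine le_trans (measure_mono ?_)
    (Measure.le_map_apply (measurable_decorate (M.liftStep f)).aemeasurable _)
  intro ξ hξ
  refine (Acceptance.sat_comap_iff _ _ _).2 ?_
  have := hE _ hξ
  simp only [← stepTrace_initialSegment] at this
  exact this

end MDP

/-! ### Criteria for being good for MDPs. -/

namespace OmegaAutomaton

variable {α Q : Type*} [Finite Q] {A : OmegaAutomaton α Q}

/-- If the language of `A` is exhausted by sets on each of which some resolver produces accepting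
runs only, then `A` is good for MDPs. -/
theorem isGFM_of_resolvers (f : ℕ → List α → Q) (hf : ∀ n, A.IsResolver (f n))
    (E : ℕ → Set (ℕ → α)) (hmono : Monotone E) (hL : A.language ⊆ ⋃ n, E n)
    (hE : ∀ n, ∀ w ∈ E n, A.acc.Sat fun k => f n (initialSegment k w)) : A.IsGFM := by
  intro S Act _ _ M
  refine le_antisymm (iSup_le fun σ => ?_) (MDP.psyn_le_psem M A)
  have h1 : {ξ | M.trace ξ ∈ A.language} ⊆ ⋃ n, {ξ | M.trace ξ ∈ E n} := by
    intro ξ hξ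
    obtain ⟨n, hn⟩ := Set.mem_iUnion.1 (hL hξ)
    exact Set.mem_iUnion.2 ⟨n, hn⟩
  refine (measure_mono h1).trans ?_
  -- Continuity from below along an increasing sequence, valid without measurability; the resolver
  -- may therefore vary with `n`.
  have h2 : Monotone fun n => {ξ | M.trace ξ ∈ E n} := fun m n hmn ξ hξ => hmono hmn hξ
  rw [h2.measure_iUnion]
  exact iSup_le fun n => MDP.pathMeasure_le_psyn (hf n) σ (E n) (hE n)

theorem isGFM_of_isDeterministic (hA : A.toTS.IsDeterministic) : A.IsGFM := by
  let f : List α → Q := fun u => u.foldl (fun q a => (A.complete q a).some) A.init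
  have hf : A.IsResolver f := ⟨rfl, fun u a => by
    simp only [f, List.foldl_append, List.foldl_cons, List.foldl_nil]
    exact (A.complete _ _).some_mem⟩
  refine isGFM_of_resolvers (fun _ => f) (fun _ => hf) (fun _ => A.language) monotone_const
    (fun w hw => Set.mem_iUnion.2 ⟨0, hw⟩) ?_
  rintro - w ⟨ρ, hρ, hacc⟩
  have : ρ = fun k => f (initialSegment k w) := by
    funext k
    induction k with
    | zero => exact hρ.1
    | succ k ih =>
      have h := (hf.isRun w).2 k
      exact hA _ _ (hρ.2 k) (by rw [ih]; exact h)
  exact this ▸ hacc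

end OmegaAutomaton

/-! ### The leaf automata. -/

namespace TS

variable {α Q : Type*} {T : TS α Q} {q : Q} {a : α}

theorem completion_δ_of_nonempty (h : (T.δ q a).Nonempty) :
    T.completion.δ (some q) a = some '' T.δ q a :=
  if_pos h

theorem completion_δ_of_not_nonempty (h : ¬ (T.δ q a).Nonempty) :
    T.completion.δ (some q) a = {none} :=
  if_neg h

theorem some_mem_completion_δ {x : Option Q} {y : Q} :
    some y ∈ T.completion.δ x a ↔ ∃ p, x = some p ∧ y ∈ T.δ p a := by
  rcases x with _ | p
  · simp [completion]
  · by_cases h : (T.δ p a).Nonempty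
    · simp [completion_δ_of_nonempty h]
    · simp only [completion_δ_of_not_nonempty h]
      simp only [Set.mem_singleton_iff, reduceCtorEq, Option.some.injEq, exists_eq_left', false_iff]
      exact fun hy => h ⟨y, hy⟩

end TS

namespace DFA

variable {α Q : Type*} (D : DFA α Q)

theorem isDeterministic_toTS : D.toTS.IsDeterministic := fun _ _ =>
  Set.subsingleton_singleton

theorem isDBA_readBuchi : D.readBuchi.IsDBA := ⟨D.isDeterministic_toTS, _, rfl⟩

theorem isGFM_readBuchi [Finite Q] : D.readBuchi.IsGFM :=
  OmegaAutomaton.isGFM_of_isDeterministic D.isDeterministic_toTS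

open scoped Classical in
/-- The transition function of `existsForallAut` with the jump made when `jump` holds and the
jump is possible. -/
noncomputable def jumpStep (jump : Prop) (x : Option (Q × Bool)) (a : α) : Option (Q × Bool) :=
  match x with
  | none => none
  | some (q, false) => some (D.step q a, decide (jump ∧ D.step q a ∈ D.accept))
  | some (q, true) =>
    if q ∈ D.accept ∧ D.step q a ∈ D.accept then some (D.step q a, true) else none

theorem jumpStep_mem (jump : Prop) (x : Option (Q × Bool)) (a : α) :
    D.jumpStep jump x a ∈ D.existsForallAut.δ x a := by
  classical
  change _ ∈ D.jumpTS.completion.δ x a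
  rcases x with _ | ⟨q, _ | _⟩
  · rfl
  · refine TS.some_mem_completion_δ.2 ⟨_, rfl, ?_⟩
    by_cases h : jump ∧ D.step q a ∈ D.accept
    · exact Or.inr (Or.inl ⟨rfl, by simp [h], h.2, rfl⟩)
    · exact Or.inl ⟨rfl, by simp [h], rfl⟩
  · by_cases h : q ∈ D.accept ∧ D.step q a ∈ D.accept
    · simp only [jumpStep, if_pos h]
      exact TS.some_mem_completion_δ.2 ⟨_, rfl, Or.inr (Or.inr ⟨rfl, rfl, h.1, h.2, rfl⟩)⟩
    · have hne : ¬ (D.jumpTS.δ (q, true) a).Nonempty := by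
        rintro ⟨y, ⟨h1, -⟩ | ⟨h1, -⟩ | ⟨-, -, h1, h2, h3⟩⟩
        · cases h1
        · cases h1
        · exact h ⟨h1, by rwa [h3]⟩
      simp only [TS.completion_δ_of_not_nonempty hne, jumpStep, if_neg h]
      rfl

theorem existsForallAut_δ_subsingleton {x : Option (Q × Bool)} (hx : ∀ q, x ≠ some (q, false))
    (a : α) : (D.existsForallAut.δ x a).Subsingleton := by
  classical
  change (D.jumpTS.completion.δ x a).Subsingleton
  rcases x with _ | ⟨q, _ | _⟩
  · exact Set.subsingleton_singleton
  · exact absurd rfl (hx q)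
  · simp only [TS.completion]
    split_ifs
    · refine Set.Subsingleton.image ?_ _
      rintro ⟨p, b⟩ (⟨h1, -⟩ | ⟨h1, -⟩ | ⟨-, h2, -, -, h3⟩)
      · cases h1
      · cases h1
      rintro ⟨p', b'⟩ (⟨h1, -⟩ | ⟨h1, -⟩ | ⟨-, h2', -, -, h3'⟩)
      · cases h1
      · cases h1
      exact Prod.ext (h3.symm.trans h3') (h2.trans h2'.symm)
    · exact Set.subsingleton_singleton

/-- The states of `existsForallAut` other than those before the jump form a trap. -/
theorem eq_jumpStep_of_mem {x y : Option (Q × Bool)} (hx : ∀ q, x ≠ some (q, false)) {a : α}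
    (hy : y ∈ D.existsForallAut.δ x a) : y = D.jumpStep False x a :=
  D.existsForallAut_δ_subsingleton hx a hy (D.jumpStep_mem _ _ _)

theorem jumpStep_ne {x : Option (Q × Bool)} (hx : ∀ q, x ≠ some (q, false)) (jump : Prop) (a : α)
    (p : Q) : D.jumpStep jump x a ≠ some (p, false) := by
  rcases x with _ | ⟨q, _ | _⟩
  · exact Option.some_ne_none _ |>.symm
  · exact absurd rfl (hx q)
  · simp only [jumpStep]
    split_ifs <;> simp

theorem isLDBA_existsForallAut : D.existsForallAut.IsLDBA := by
  refine ⟨_, rfl, ?_⟩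
  rintro f ⟨⟨q, b⟩, ⟨-, hb⟩, rfl⟩ - p hp
  obtain rfl : b = true := hb
  refine D.existsForallAut_δ_subsingleton ?_
  induction hp with
  | refl => intro q h; cases h
  | tail _ hstep ih =>
    obtain ⟨a, ha⟩ := hstep
    rw [D.eq_jumpStep_of_mem ih ha]
    exact D.jumpStep_ne ih _ _

theorem eval_initialSegment_succ (w : ℕ → α) (n : ℕ) :
    D.eval (initialSegment (n + 1) w) = D.step (D.eval (initialSegment n w)) (w n) := by
  rw [initialSegment_succ, eval_append_singleton]

theorem sat_existsForallAut_iff [Finite Q] (ρ : ℕ → Option (Q × Bool)) :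
    D.existsForallAut.acc.Sat ρ ↔ ∃ᶠ n in atTop, ∃ q ∈ D.accept, ρ n = some (q, true) := by
  refine (Acceptance.sat_buchi_iff _ ρ).trans (frequently_congr (Eventually.of_forall fun n => ?_))
  constructor
  · rintro ⟨⟨q, b⟩, ⟨hq, hb⟩, h⟩
    obtain rfl : b = true := hb
    exact ⟨q, hq, h.symm⟩
  · rintro ⟨q, hq, h⟩
    exact ⟨(q, true), ⟨hq, rfl⟩, h.symm⟩

/-- A run of `existsForallAut` that jumps exactly at time `n` is accepting if all later states of
the DFA are final. -/
theorem sat_of_jump_at [Finite Q] (w : ℕ → α) (jump : ℕ → Prop) (ρ : ℕ → Option (Q × Bool))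
    (h0 : ρ 0 = some (D.start, false)) (hρ : ∀ k, ρ (k + 1) = D.jumpStep (jump k) (ρ k) (w k))
    (n : ℕ) (hjump : ∀ k, jump k ↔ k = n)
    (hacc : ∀ k > n, D.eval (initialSegment k w) ∈ D.accept) : D.existsForallAut.acc.Sat ρ := by
  have h1 : ∀ k ≤ n, ρ k = some (D.eval (initialSegment k w), false) := by
    intro k
    induction k with
    | zero => exact fun _ => h0
    | succ k ih =>
      intro hk
      have : ¬ jump k := by rw [hjump]; lia
      rw [hρ, ih (by lia), eval_initialSegment_succ]
      simp [jumpStep, this]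
  -- The jump happens while letter `n` is read, so copy `1` is entered at time `n + 1`; finality at
  -- time `n` is not needed.
  have h2 : ∀ k, ρ (n + 1 + k) = some (D.eval (initialSegment (n + 1 + k) w), true) := by
    intro k
    induction k with
    | zero =>
      have h := hacc (n + 1) (by lia)
      rw [eval_initialSegment_succ] at h
      have hj : jump n := (hjump n).2 rfl
      rw [add_zero, hρ, h1 n le_rfl, eval_initialSegment_succ]
      simp [jumpStep, hj, h]
    | succ k ih =>
      have h := hacc (n + 1 + k) (by lia)
      have h' := hacc (n + 1 + k + 1) (by lia)
      rw [eval_initialSegment_succ] at h'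
      rw [← add_assoc, hρ, ih, eval_initialSegment_succ]
      simp [jumpStep, h, h']
  rw [sat_existsForallAut_iff]
  refine Eventually.frequently (eventually_atTop.2 ⟨n + 1, fun k hk => ?_⟩)
  obtain ⟨j, rfl⟩ := Nat.exists_eq_add_of_le hk
  exact ⟨_, hacc _ (by lia), h2 j⟩

/-- After a visit to an accepting state the run can neither return to copy `0` nor enter the
absorbing sink, as it must accept again. So it stays in copy `1`, where every move needs a final
target, while its first component follows `D`. -/
theorem language_existsForallAut_subset [Finite Q] {w : ℕ → α}
    (hw : w ∈ D.existsForallAut.language) :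
    ∃ n, ∀ k > n, D.eval (initialSegment k w) ∈ D.accept := by
  obtain ⟨ρ, ⟨h0, hρ⟩, hacc⟩ := hw
  rw [sat_existsForallAut_iff] at hacc
  obtain ⟨n, -, hn⟩ := frequently_atTop.1 hacc 0
  have htrap : ∀ k ≥ n, ∀ q, ρ k ≠ some (q, false) := by
    intro k hk
    induction k, hk using Nat.le_induction with
    | base =>
      obtain ⟨q, -, hq⟩ := hn
      rw [hq]
      intro p h
      cases h
    | succ k hk ih =>
      rw [D.eq_jumpStep_of_mem ih (hρ k)]
      exact D.jumpStep_ne ih _ _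
  have hnone : ∀ k ≥ n, ρ k ≠ none := by
    intro k hk h
    have : ∀ j ≥ k, ρ j = none := by
      intro j hj
      induction j, hj using Nat.le_induction with
      | base => exact h
      | succ j hj ih => rw [D.eq_jumpStep_of_mem (htrap j (hk.trans hj)) (hρ j), ih]; rfl
    obtain ⟨j, hj, q, -, hq⟩ := frequently_atTop.1 hacc k
    rw [this j hj] at hq
    cases hq
  have hrun : ∀ k, ∀ y, ρ k = some y → y.1 = D.eval (initialSegment k w) := by
    intro k
    induction k with
    | zero =>
      intro y hy
      have : some y = some (D.start, false) := hy.symm.trans h0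
      cases this
      rfl
    | succ k ih =>
      intro y hy
      have h := hρ k
      rw [hy] at h
      obtain ⟨x, hx, hxy⟩ := TS.some_mem_completion_δ.1 h
      rw [eval_initialSegment_succ, ← ih x hx]
      rcases hxy with ⟨-, -, e⟩ | ⟨-, -, -, e⟩ | ⟨-, -, -, -, e⟩ <;> exact e.symm
  refine ⟨n, fun k hk => ?_⟩
  obtain ⟨k, rfl⟩ : ∃ j, k = j + 1 := ⟨k - 1, by lia⟩
  have h1 := D.eq_jumpStep_of_mem (htrap k (by lia)) (hρ k)
  have h2 := hnone (k + 1) (by lia)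
  obtain ⟨⟨q, b⟩, hq⟩ := Option.ne_none_iff_exists'.1 (hnone k (by lia))
  have hb : b = true := by
    rcases b with _ | _
    · exact absurd hq (htrap k (by lia) q)
    · rfl
  subst hb
  rw [eval_initialSegment_succ, ← hrun k _ hq]
  rw [hq] at h1
  by_contra hne
  exact h2 (h1.trans (if_neg fun h => hne h.2))

/-- The right moment to jump depends on the future, so the `n`-th resolver jumps at time `n`; it is
accepting on the words whose run in `D` is final after `n`, and these sets increase. -/
theorem isGFM_existsForallAut [Finite Q] : D.existsForallAut.IsGFM := by
  -- The first component counts the letters read, so that the fold knows when to jump.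
  let g : ℕ → List α → ℕ × Option (Q × Bool) := fun n u =>
    u.foldl (fun y a => (y.1 + 1, D.jumpStep (y.1 = n) y.2 a)) (0, some (D.start, false))
  have hg : ∀ n u a, g n (u ++ [a]) = ((g n u).1 + 1, D.jumpStep ((g n u).1 = n) (g n u).2 a) :=
    fun n u a => by simp [g]
  have hlen : ∀ n k w, (g n (initialSegment k w)).1 = k := by
    intro n k w
    induction k with
    | zero => rfl
    | succ k ih => rw [initialSegment_succ, hg, ih]
  refine OmegaAutomaton.isGFM_of_resolvers (fun n u => (g n u).2)
    (fun n => ⟨rfl, fun u a => ?_⟩)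
    (fun n => {w | ∀ k > n, D.eval (initialSegment k w) ∈ D.accept})
    (fun m n hmn w hw k hk => hw k (lt_of_le_of_lt hmn hk))
    (fun w hw => Set.mem_iUnion.2 (D.language_existsForallAut_subset hw)) ?_
  · simp only [hg]
    exact D.jumpStep_mem _ _ _
  · intro n w hw
    refine D.sat_of_jump_at w (fun k => k = n) _ rfl (fun k => ?_) n (fun k => Iff.rfl) hw
    simp only [initialSegment_succ, hg, hlen]

/-! ### The AEC-simulation. -/

theorem isDCA_existsForallDCA : D.existsForallDCA.IsDCA :=
  ⟨Dᶜ.isDeterministic_toTS, _, rfl⟩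

theorem spoilerRun_existsForallDCA {m : ℕ → SpoilerMove α Q}
    (hm : AEC.LegalSpoiler D.existsForallDCA m) (k : ℕ) :
    AEC.spoilerRun D.existsForallDCA m k =
      D.eval (initialSegment k fun n => (m n).letter) := by
  induction k with
  | zero => rfl
  | succ k ih =>
    rw [eval_initialSegment_succ, ← ih]
    exact hm.1.2 k

/-- Duplicator wins by jumping in the round in which Spoiler makes her claim. -/
theorem aecSimulates_existsForall [Finite Q] :
    D.existsForallAut.AECSimulates D.existsForallDCA := by
  let τ : List (SpoilerMove α Q) → Option (Q × Bool) := fun l =>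
    l.foldl (fun x c => D.jumpStep (c.claim ≠ none) x c.letter) (some (D.start, false))
  refine ⟨τ, fun m hm => ?_⟩
  have hrun : ∀ k, AEC.duplicatorRun D.existsForallAut τ m (k + 1) =
      D.jumpStep ((m k).claim ≠ none) (AEC.duplicatorRun D.existsForallAut τ m k)
        (m k).letter := by
    have h : ∀ k, AEC.duplicatorRun D.existsForallAut τ m k = τ ((List.range k).map m) := by
      rintro (_ | k) <;> rfl
    intro k
    rw [h, h, List.range_succ, List.map_append]
    simp [τ]
  refine ⟨⟨rfl, fun k => by rw [hrun]; exact D.jumpStep_mem _ _ _⟩, ?_⟩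
  by_cases hclaim : ∀ n, (m n).claim = none
  · exact Or.inl hclaim
  by_cases hacc : D.existsForallDCA.acc.Sat (AEC.spoilerRun D.existsForallDCA m)
  swap
  · exact Or.inr (Or.inr (Or.inr hacc))
  push Not at hclaim
  obtain ⟨n, hn⟩ := hclaim
  obtain ⟨Λ, hΛ⟩ := Option.ne_none_iff_exists'.1 hn
  by_cases hcomp : AEC.Complies (AEC.spoilerTransitions D.existsForallDCA m) n Λ
  swap
  · exact Or.inr (Or.inr (Or.inl ⟨n, Λ, hΛ, hcomp⟩))
  refine Or.inr (Or.inl ?_)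
  refine D.sat_of_jump_at (fun k => (m k).letter) (fun k => (m k).claim ≠ none) _ rfl hrun n
    (fun k => ⟨fun hk => hm.2 _ _ hk hn, fun hk => hk ▸ hn⟩) fun k hk => ?_
  -- Compliance is used only for one-letter sequences: the transition at time `k > n` belongs to `Λ`
  -- and hence recurs infinitely often.
  have hinf := (hcomp.1 [AEC.spoilerTransitions D.existsForallDCA m k] (by simp)).1
    (hcomp.2 _ (by simp) k hk (by simp [AEC.OccursAt]))
  have hev : ∀ᶠ j in atTop, AEC.spoilerRun D.existsForallDCA m j ∉ (Dᶜ).accept :=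
    (Acceptance.sat_coBuchi_iff _ _).1 hacc
  -- Some recurrence comes after the last visit to a rejecting state, so its source, which is also
  -- the state at time `k`, is final in `D`.
  obtain ⟨j, hj, hjF⟩ := (hinf.and_eventually hev).exists
  have e : AEC.spoilerRun D.existsForallDCA m j = AEC.spoilerRun D.existsForallDCA m k := by
    have : AEC.spoilerTransitions D.existsForallDCA m j =
        AEC.spoilerTransitions D.existsForallDCA m k := by
      simpa [AEC.OccursAt] using hj
    exact congrArg Prod.fst this
  rw [e, D.spoilerRun_existsForallDCA hm] at hjF
  exact not_not.1 hjF

end DFA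

theorem mainTheorem5 {AP : Type*} [Finite AP] (φ : FinTraceFormula AP)
    {Q : Type*} [Finite Q] (D : DFA (Set AP) Q) (hD : D.accepts = φ.language)
    {P : Type*} [Finite P] (C : DFA (Set AP) P) (hC : C.accepts = φ.neg.language) :
    (D.existsAut.IsDBA ∧ D.existsAut.IsGFM) ∧
    (C.forallAut.IsDBA ∧ C.forallAut.IsGFM) ∧
    (D.forallExistsAut.IsDBA ∧ D.forallExistsAut.IsGFM) ∧
    (D.existsForallDCA.IsDCA ∧ D.existsForallAut.IsLDBA ∧
      D.existsForallAut.AECSimulates D.existsForallDCA ∧ D.existsForallAut.IsGFM) := by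
  exact ⟨⟨D.sinkFinal.isDBA_readBuchi, D.sinkFinal.isGFM_readBuchi⟩,
    ⟨(C.sinkFinal.trim)ᶜ.isDBA_readBuchi, (C.sinkFinal.trim)ᶜ.isGFM_readBuchi⟩,
    ⟨D.isDBA_readBuchi, D.isGFM_readBuchi⟩,
    D.isDCA_existsForallDCA, D.isLDBA_existsForallAut, D.aecSimulates_existsForall,
    D.isGFM_existsForallAut⟩
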